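/- The magic square game: Alice and Bob receive $x^{(A)},x^{(B)}\in\{1,2,3\}$ and, without communicating, output bits $(y^{(A)}_1,y^{(A)}_2,y^{(A)}_3)$ and $(y^{(B)}_1,y^{(B)}_2,y^{(B)}_3)$. They win if $y^{(A)}_3=y^{(A)}_1\oplus y^{(A)}_2$, $\;y^{(B)}_3=y^{(B)}_1\oplus y^{(B)}_2\oplus 1$ and $y^{(A)}_{x^{(B)}}=y^{(B)}_{x^{(A)}}$. The magic square correlations are the conditional probabilities $\Pr(y^{(A)},y^{(B)}\mid x^{(A)},x^{(B)})$ under which, for every input pair, the output pair is uniformly distributed among all winning output pairs. A non-local box (NLB) takes a bit $u$ from Alice and a bit $v$ from Bob and returns bits $s$ to Alice and $t$ to Bob with $s\oplus t=u\wedge v$, both solutions being equally likely. **Corollary.** An NLB can simulate bipartite correlations that no pair of qubits $\alpha|00\rangle+\beta|11\rangle$ can produce. Precisely: 1. The magic square correlations win the magic square game with probability one on every input pair, and they are obtained from local measurements (POVMs) of the state $\frac12(|0011\rangle-|0110\rangle-|1001\rangle+|1100\rangle)$, of which Alice holds the first two qubits and Bob the last two. 2. There is a classical protocol without communication, with (finite)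 shared randomness and a single use of one NLB, that produces exactly the magic square correlations. 3. For all $\alpha,\beta\in\mathbb{C}$ with $|\alpha|^2+|\beta|^2=1$, no choice of local measurements (POVMs) of the state $\alpha|00\rangle+\beta|11\rangle$, of which each player holds one qubit, produces the magic square correlations, or any other correlations that win the magic square game with probability one on every input pair. This remains true if the measurements may also depend on shared classical randomness. -/

import Mathlib

open scoped Kronecker Matrix ComplexOrder

noncomputable section

/-- A bipartite game: Alice has inputs `XA` and outputs `YA`, Bob has inputs `XB` and outputs
`YB`, and `rel` is the winning relation. -/
structure BipartiteGame (XA XB YA YB : Type) where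
  rel : XA → XB → YA → YB → Prop

/-- A table of conditional probabilities `p x y a b = Pr (a, b | x, y)`. -/
abbrev Correlation (XA XB YA YB : Type) : Type := XA → XB → YA → YB → ℝ

section General

variable {XA XB YA YB : Type} [Fintype YA] [Fintype YB]

open Classical in
/-- On every input pair, the outputs satisfy the winning relation with probability one. -/
def BipartiteGame.IsWonBy (G : BipartiteGame XA XB YA YB) (p : Correlation XA XB YA YB) : Prop :=
  ∀ x y, ∑ a, ∑ b, (if G.rel x y a b then p x y a b else 0) = 1

open Classical in
/-- On every input pair, the outputs are uniform among all winning output pairs. -/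
def BipartiteGame.uniformWinning (G : BipartiteGame XA XB YA YB) : Correlation XA XB YA YB :=
  fun x y a b =>
    if G.rel x y a b then 1 / (Nat.card {o : YA × YB // G.rel x y o.1 o.2} : ℝ) else 0

end General

/-- The magic square game (inputs indexed by `0, 1, 2`). -/
def magicSquareGame : BipartiteGame (Fin 3) (Fin 3) (Fin 3 → Bool) (Fin 3 → Bool) where
  rel xA xB yA yB :=
    yA 2 = xor (yA 0) (yA 1) ∧
    yB 2 = xor (xor (yB 0) (yB 1)) true ∧
    yA xB = yB xA

/-- The magic square correlations. -/
def magicSquareCorrelation : Correlation (Fin 3) (Fin 3) (Fin 3 → Bool) (Fin 3 → Bool) :=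
  magicSquareGame.uniformWinning

/-! Non-local boxes -/

/-- The non-local box: `nlb u v s t` is the probability that it returns `s` to Alice and `t` to
Bob on inputs `u` and `v`. The two solutions of `u ∧ v = s ⊕ t` are equally likely. -/
def nlb (u v s t : Bool) : ℝ := if (u && v) = xor s t then 1 / 2 else 0

/-- A classical protocol without communication that uses one non-local box once. The players
share a random value `r`, drawn from a finite set `Λ` with probability `weight r`. Each player
computes an input to the box from `r` and the player's own game input, and then the final output
from these and the bit that the box returned. -/
structure NLBProtocol (XA XB YA YB : Type) where
  Λ : Type
  [fintypeΛ : Fintype Λ]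
  weight : Λ → ℝ
  weight_nonneg : ∀ r, 0 ≤ weight r
  weight_sum : ∑ r, weight r = 1
  boxA : Λ → XA → Bool
  boxB : Λ → XB → Bool
  outA : Λ → XA → Bool → YA
  outB : Λ → XB → Bool → YB

attribute [instance] NLBProtocol.fintypeΛ

open Classical in
/-- The correlation that a protocol with one non-local box produces. -/
def NLBProtocol.correlation {XA XB YA YB : Type} (P : NLBProtocol XA XB YA YB) :
    Correlation XA XB YA YB :=
  fun x y a b =>
    ∑ r, P.weight r * ∑ s, ∑ t,
      if P.outA r x s = a ∧ P.outB r y t = b then nlb (P.boxA r x) (P.boxB r y) s t else 0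

/-! Quantum strategies -/

/-- A measurement (POVM) with outcomes in `Y` on the system with Hilbert space `ℂ^n`. -/
structure POVM (n Y : Type) [Fintype n] [DecidableEq n] [Fintype Y] where
  effect : Y → Matrix n n ℂ
  posSemidef : ∀ a, (effect a).PosSemidef
  sum_eq_one : ∑ a, effect a = 1

section Quantum

variable {m n XA XB YA YB : Type} [Fintype m] [DecidableEq m] [Fintype n] [DecidableEq n]
  [Fintype YA] [Fintype YB]

/-- The Born rule `⟨ψ| E ⊗ F |ψ⟩`. -/
def bornProb (ψ : m × n → ℂ) (E : Matrix m m ℂ) (F : Matrix n n ℂ) : ℝ :=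
  (star ψ ⬝ᵥ ((E ⊗ₖ F) *ᵥ ψ)).re

/-- `p` arises from local measurements, chosen according to the inputs, of the shared state `ψ`. -/
def IsQuantum (ψ : m × n → ℂ) (p : Correlation XA XB YA YB) : Prop :=
  ∃ (M : XA → POVM m YA) (N : XB → POVM n YB),
    ∀ x y a b, p x y a b = bornProb ψ ((M x).effect a) ((N y).effect b)

/-- `p` arises from local measurements of the shared state `ψ`, where the measurements may also
depend on shared classical randomness, given by an arbitrary probability space. -/
def IsQuantumWithSharedRandomness (ψ : m × n → ℂ) (p : Correlation XA XB YA YB) : Prop :=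
  ∃ (Ω : Type) (_ : MeasurableSpace Ω) (μ : MeasureTheory.Measure Ω)
    (_ : MeasureTheory.IsProbabilityMeasure μ)
    (M : Ω → XA → POVM m YA) (N : Ω → XB → POVM n YB),
    (∀ x a i j, Measurable fun ω => (M ω x).effect a i j) ∧
    (∀ y b i j, Measurable fun ω => (N ω y).effect b i j) ∧
    ∀ x y a b, p x y a b = ∫ ω, bornProb ψ ((M ω x).effect a) ((N ω y).effect b) ∂μ

end Quantum

/-- The state `α|00⟩ + β|11⟩` of a pair of qubits, one held by each player. -/
def qubitPair (α β : ℂ) : Fin 2 × Fin 2 → ℂ :=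
  α • Pi.single (0, 0) 1 + β • Pi.single (1, 1) 1

/-- The basis vector `|i j k l⟩` of four qubits: Alice holds the first two, Bob the last two. -/
def ket4 (i j k l : Fin 2) : (Fin 2 × Fin 2) × (Fin 2 × Fin 2) → ℂ :=
  Pi.single ((i, j), (k, l)) 1

/-- The state `(|0011⟩ - |0110⟩ - |1001⟩ + |1100⟩) / 2`. -/
def magicState : (Fin 2 × Fin 2) × (Fin 2 × Fin 2) → ℂ :=
  (1 / 2 : ℂ) • (ket4 0 0 1 1 - ket4 0 1 1 0 - ket4 1 0 0 1 + ket4 1 1 0 0)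

end

/-! ### Uniform distribution on the winning outputs -/

section Uniform
variable {XA XB YA YB : Type} [Fintype YA] [Fintype YB]

/-! The box protocol starts from a shared random matrix with even rows and columns. Making Bob's
columns odd spoils agreement in a single cell, and one non-local box repairs exactly that cell. Both
this protocol and the four-qubit strategy reduce to finite computations over the integers
(`sum_boxOut`, `magicForm_scaledEffect`).

For the impossibility, write the state as a matrix `D = diag(α, β)`. Winning with certainty forces
`M a * D * (N b)ᵀ = 0` on losing outputs. If `D` is invertible, conjugating Bob's side by `D` turns
the effects into a magic square of `2 × 2` matrices (`isMagicSquare_of_mul_eq_zero`), and none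
exists (`not_isMagicSquare_two`). Otherwise the state is a product and yields a deterministic
winning strategy, against parity (`magicSquareGame.not_forall_rel`). Shared randomness is removed by
fixing one good value (`exists_isQuantum_isWonBy`). -/

theorem BipartiteGame.isWonBy_uniformWinning (G : BipartiteGame XA XB YA YB)
    (h : ∀ x y, ∃ a b, G.rel x y a b) : G.IsWonBy G.uniformWinning := by
  classical
  intro x y
  have hcard : (Nat.card {o : YA × YB // G.rel x y o.1 o.2} : ℝ) ≠ 0 := by
    obtain ⟨a, b, hab⟩ := h x y
    have : Nonempty {o : YA × YB // G.rel x y o.1 o.2} := ⟨⟨(a, b), hab⟩⟩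
    exact_mod_cast Nat.card_pos.ne'
  have key : ∀ a b, (if G.rel x y a b then G.uniformWinning x y a b else 0)
      = if G.rel x y a b then 1 / (Nat.card {o : YA × YB // G.rel x y o.1 o.2} : ℝ) else 0 := by
    intro a b
    by_cases hab : G.rel x y a b <;> simp [BipartiteGame.uniformWinning, hab]
  simp only [key]
  rw [← Fintype.sum_prod_type' (f := fun a b => if G.rel x y a b then
    1 / (Nat.card {o : YA × YB // G.rel x y o.1 o.2} : ℝ) else 0), ← Finset.sum_filter,
    Finset.sum_const, nsmul_eq_mul, ← Fintype.card_subtype, ← Nat.card_eq_fintype_card,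
    mul_one_div_cancel hcard]

end Uniform

instance magicSquareGame.decidableRel (x y : Fin 3) (a b : Fin 3 → Bool) :
    Decidable (magicSquareGame.rel x y a b) :=
  inferInstanceAs (Decidable (_ ∧ _ ∧ _))

theorem magicSquareGame.exists_rel (x y : Fin 3) : ∃ a b, magicSquareGame.rel x y a b := by
  revert x y; decide +kernel

/-- Four even rows for Alice, then two odd columns for Bob with the prescribed common entry. -/
theorem magicSquareGame.card_rel (x y : Fin 3) :
    Fintype.card {o : (Fin 3 → Bool) × (Fin 3 → Bool) // magicSquareGame.rel x y o.1 o.2} = 8 := by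
  revert x y; decide +kernel

theorem magicSquareCorrelation_apply (x y : Fin 3) (a b : Fin 3 → Bool) :
    magicSquareCorrelation x y a b = if magicSquareGame.rel x y a b then 1 / 8 else 0 := by
  rw [magicSquareCorrelation, BipartiteGame.uniformWinning, Nat.card_eq_fintype_card,
    magicSquareGame.card_rel]
  norm_num

theorem magicSquareGame.isWonBy_magicSquareCorrelation :
    magicSquareGame.IsWonBy magicSquareCorrelation :=
  magicSquareGame.isWonBy_uniformWinning magicSquareGame.exists_rel

/-! The protocol with a non-local box. -/

/-- The 0-1 matrices with even rows and columns, parametrized by their upper left block. -/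
def evenMatrix (r : Bool × Bool × Bool × Bool) : Matrix (Fin 3) (Fin 3) Bool :=
  let (p, q, s, t) := r
  !![p, q, xor p q; s, t, xor s t; xor p s, xor q t, xor (xor p q) (xor s t)]

/-- The even matrix supported on the last two rows and columns, by which the players flip their
outputs when the box returns `true`. -/
def flipMatrix : Matrix (Fin 3) (Fin 3) Bool := evenMatrix (false, false, false, true)

/-- Alice's output: her row of `evenMatrix r`, plus `flipMatrix` if the box returned `true`, plus
the row `(1, 1, 0)` on the last input. -/
def boxOutA (r : Bool × Bool × Bool × Bool) (x : Fin 3) (s : Bool) : Fin 3 → Bool :=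
  fun y => xor (xor (evenMatrix r x y) (s && flipMatrix x y)) (decide (x = 2) && !decide (y = 2))

/-- Bob's output: his column of `evenMatrix r`, plus `flipMatrix` if the box returned `true`, plus
the column `(0, 0, 1)`. Without the box he disagrees with Alice in the last cell only. -/
def boxOutB (r : Bool × Bool × Bool × Bool) (y : Fin 3) (t : Bool) : Fin 3 → Bool :=
  fun x => xor (xor (evenMatrix r x y) (t && flipMatrix x y)) (decide (x = 2))

/-- The 16 matrices and 2 box solutions give 32 equally likely cases, spread evenly over 8 winning
outputs. -/
theorem sum_boxOut (x y : Fin 3) (a b : Fin 3 → Bool) :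
    (∑ r, ∑ s, ∑ t, if (boxOutA r x s = a ∧ boxOutB r y t = b) ∧
      (decide (x = 2) && decide (y = 2)) = xor s t then 1 else 0 : ℕ) =
      if magicSquareGame.rel x y a b then 4 else 0 := by
  revert x y a b; decide +kernel

/-- A protocol for the magic square game with one non-local box. -/
noncomputable def magicSquareProtocol :
    NLBProtocol (Fin 3) (Fin 3) (Fin 3 → Bool) (Fin 3 → Bool) where
  Λ := Bool × Bool × Bool × Bool
  weight _ := 1 / 16
  weight_nonneg _ := by norm_num
  weight_sum := by norm_num
  boxA _ x := decide (x = 2)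
  boxB _ y := decide (y = 2)
  outA := boxOutA
  outB := boxOutB

theorem magicSquareProtocol_correlation :
    magicSquareProtocol.correlation = magicSquareCorrelation := by
  funext x y a b
  have key : magicSquareProtocol.correlation x y a b =
      1 / 32 * ((∑ r, ∑ s, ∑ t, if (boxOutA r x s = a ∧ boxOutB r y t = b) ∧
      (decide (x = 2) && decide (y = 2)) = xor s t then 1 else 0 : ℕ) : ℝ) := by
    simp only [NLBProtocol.correlation, magicSquareProtocol, nlb, Nat.cast_sum, Finset.mul_sum]
    refine Finset.sum_congr rfl fun r _ => Finset.sum_congr rfl fun s _ =>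
      Finset.sum_congr rfl fun t _ => ?_
    rw [ite_and (boxOutA r x s = a ∧ boxOutB r y t = b)]
    split_ifs <;> norm_num <;> tauto
  rw [key, sum_boxOut, magicSquareCorrelation_apply]
  split_ifs <;> norm_num

/-! The quantum winning strategy. -/

/-- The eigenvalue `(-1) ^ c` of an observable that corresponds to the outcome `c`. -/
def bitSign (c : Bool) : ℤ := if c then -1 else 1

/-- The Pauli matrix `X`. -/
def pauliX : Matrix (Fin 2) (Fin 2) ℤ := !![0, 1; 1, 0]

/-- The real matrix `iY`, where `Y` is the Pauli matrix. -/
def pauliIY : Matrix (Fin 2) (Fin 2) ℤ := !![0, 1; -1, 0]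

/-- The Pauli matrix `Z`. -/
def pauliZ : Matrix (Fin 2) (Fin 2) ℤ := !![1, 0; 0, -1]

/-- Alice's observables; on each row they commute and their product is `1`. -/
def observableA : Fin 3 → Fin 3 → Matrix (Fin 2 × Fin 2) (Fin 2 × Fin 2) ℤ :=
  ![![-(pauliX ⊗ₖ 1), -(1 ⊗ₖ pauliX), pauliX ⊗ₖ pauliX],
    ![1 ⊗ₖ pauliZ, pauliZ ⊗ₖ 1, pauliZ ⊗ₖ pauliZ],
    -- The last entry is `Y ⊗ Y`, written with integer entries.
    ![pauliX ⊗ₖ pauliZ, pauliZ ⊗ₖ pauliX, -(pauliIY ⊗ₖ pauliIY)]]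

/-- Bob's observables; on each column they commute and their product is `-1`. -/
def observableB : Fin 3 → Fin 3 → Matrix (Fin 2 × Fin 2) (Fin 2 × Fin 2) ℤ :=
  ![![pauliX ⊗ₖ 1, 1 ⊗ₖ pauliX, pauliX ⊗ₖ pauliX],
    ![-(1 ⊗ₖ pauliZ), -(pauliZ ⊗ₖ 1), pauliZ ⊗ₖ pauliZ],
    ![pauliX ⊗ₖ pauliZ, pauliZ ⊗ₖ pauliX, -(pauliIY ⊗ₖ pauliIY)]]

/-- Four times the projection onto the joint eigenspace of Alice's observables on row `x` with
outcomes `a`. -/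
def scaledEffectA (x : Fin 3) (a : Fin 3 → Bool) : Matrix (Fin 2 × Fin 2) (Fin 2 × Fin 2) ℤ :=
  if a 2 = xor (a 0) (a 1) then 1 + ∑ y, bitSign (a y) • observableA x y else 0

/-- Four times the projection onto the joint eigenspace of Bob's observables on column `y` with
outcomes `b`. -/
def scaledEffectB (y : Fin 3) (b : Fin 3 → Bool) : Matrix (Fin 2 × Fin 2) (Fin 2 × Fin 2) ℤ :=
  if b 2 = xor (xor (b 0) (b 1)) true then 1 + ∑ x, bitSign (b x) • observableB x y else 0

/-- The projective measurement with effects `G a / 4`, for integral matrices `G a`. -/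
noncomputable def POVM.ofScaledProj {n Y : Type} [Fintype n] [DecidableEq n] [Fintype Y]
    (G : Y → Matrix n n ℤ) (hG : ∀ a, (G a)ᵀ * G a = 4 • G a) (hsum : ∑ a, G a = 4 • 1) :
    POVM n Y where
  effect a := (1 / 4 : ℂ) • (G a).map (Int.castRingHom ℂ)
  posSemidef a := by
    have h : (1 / 4 : ℂ) • (G a).map (Int.castRingHom ℂ) =
        ((1 / 4 : ℂ) • (G a).map (Int.castRingHom ℂ))ᴴ *
          ((1 / 4 : ℂ) • (G a).map (Int.castRingHom ℂ)) := by
      have h1 : ((G a).map (Int.castRingHom ℂ))ᴴ = (G a)ᵀ.map (Int.castRingHom ℂ) := by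
        ext i j; simp
      rw [Matrix.conjTranspose_smul, h1, Matrix.smul_mul, Matrix.mul_smul, ← Matrix.map_mul, hG]
      ext i j
      simp only [Matrix.smul_apply, Matrix.map_apply, map_nsmul]
      simp
    rw [h]
    exact Matrix.posSemidef_conjTranspose_mul_self _
  sum_eq_one := by
    have h := congrArg (fun A => A.map (Int.castRingHom ℂ)) hsum
    ext i j
    have hij := congrFun (congrFun h i) j
    simp only [Matrix.map_apply, Matrix.sum_apply, Matrix.smul_apply, map_sum] at hij ⊢
    rw [← Finset.smul_sum, hij]
    by_cases hi : i = j <;> simp [Matrix.one_apply, hi]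

/-- For outputs of the right parity, the scaled effect is `(1 + S) * (1 + T)`, with `S` and `T` the
first two signed observables: commuting symmetric involutions whose product is the third. -/
theorem scaledEffectA_proj (x : Fin 3) (a : Fin 3 → Bool) :
    (scaledEffectA x a)ᵀ * scaledEffectA x a = 4 • scaledEffectA x a := by
  revert x a; decide +kernel

theorem scaledEffectB_proj (y : Fin 3) (b : Fin 3 → Bool) :
    (scaledEffectB y b)ᵀ * scaledEffectB y b = 4 • scaledEffectB y b := by
  revert y b; decide +kernel

theorem sum_scaledEffectA (x : Fin 3) : ∑ a, scaledEffectA x a = 4 • 1 := by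
  revert x; decide +kernel

theorem sum_scaledEffectB (y : Fin 3) : ∑ b, scaledEffectB y b = 4 • 1 := by
  revert y; decide +kernel

/-- The sign of the component `|p q⟩` of `magicState`, where `q` is opposite to `p`. -/
def magicSign (p : Fin 2 × Fin 2) : ℤ := if p.1 = p.2 then 1 else -1

/-- The integral form of the Born rule for `magicState`. -/
def magicForm (G H : Matrix (Fin 2 × Fin 2) (Fin 2 × Fin 2) ℤ) : ℤ :=
  ∑ p, ∑ q, magicSign p * magicSign q * G p q * H (p.1.rev, p.2.rev) (q.1.rev, q.2.rev)

theorem magicForm_scaledEffect (x y : Fin 3) (a b : Fin 3 → Bool) :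
    magicForm (scaledEffectA x a) (scaledEffectB y b) =
      if magicSquareGame.rel x y a b then 8 else 0 := by
  revert x y a b; decide +kernel

theorem magicState_apply (i : (Fin 2 × Fin 2) × (Fin 2 × Fin 2)) :
    magicState i = if i.2 = (i.1.1.rev, i.1.2.rev) then (1 / 2 : ℂ) * magicSign i.1 else 0 := by
  obtain ⟨⟨i, j⟩, k, l⟩ := i
  fin_cases i <;> fin_cases j <;> fin_cases k <;> fin_cases l <;>
    simp [magicState, ket4, magicSign]

/-- Bob's basis label is the complement of Alice's, so the sums run over her labels only. The factor
64 combines two effects scaled by 4 and two amplitudes `±1/2`. -/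
theorem bornProb_magicState (G H : Matrix (Fin 2 × Fin 2) (Fin 2 × Fin 2) ℤ) :
    bornProb magicState ((1 / 4 : ℂ) • G.map (Int.castRingHom ℂ))
      ((1 / 4 : ℂ) • H.map (Int.castRingHom ℂ)) = magicForm G H / 64 := by
  have key : star magicState ⬝ᵥ ((((1 / 4 : ℂ) • G.map (Int.castRingHom ℂ)) ⊗ₖ
      ((1 / 4 : ℂ) • H.map (Int.castRingHom ℂ))) *ᵥ magicState) = ((magicForm G H / 64 : ℝ) : ℂ) := by
    simp only [dotProduct, Matrix.mulVec, Fintype.sum_prod_type (α₁ := Fin 2 × Fin 2),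
      Pi.star_apply, magicState_apply, mul_ite, mul_zero, Finset.sum_ite_eq', Finset.mem_univ,
      if_true, apply_ite star, star_zero, ite_mul, zero_mul]
    simp only [magicForm, Matrix.kroneckerMap_apply, Matrix.smul_apply, Matrix.map_apply]
    push_cast
    rw [Finset.sum_div]
    refine Finset.sum_congr rfl fun p _ => ?_
    rw [Finset.sum_div, Finset.mul_sum]
    refine Finset.sum_congr rfl fun q _ => ?_
    simp
    ring
  rw [bornProb, key, Complex.ofReal_re]

theorem isQuantum_magicSquareCorrelation : IsQuantum magicState magicSquareCorrelation := by
  refine ⟨fun x => POVM.ofScaledProj (scaledEffectA x) (scaledEffectA_proj x) (sum_scaledEffectA x),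
    fun y => POVM.ofScaledProj (scaledEffectB y) (scaledEffectB_proj y) (sum_scaledEffectB y),
    fun x y a b => ?_⟩
  simp only [POVM.ofScaledProj]
  rw [bornProb_magicState, magicForm_scaledEffect, magicSquareCorrelation_apply]
  split_ifs <;> norm_num

/-! ### Magic squares in a ring, and their absence among `2 × 2` matrices -/

section Ring
variable {R : Type*} [Ring R]

/-- Nine elements of a ring that satisfy the relations of the magic square. -/
structure IsMagicSquare (O : Fin 3 → Fin 3 → R) : Prop where
  mul_self : ∀ x y, O x y * O x y = 1
  row_comm : ∀ x y y', Commute (O x y) (O x y')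
  col_comm : ∀ x x' y, Commute (O x y) (O x' y)
  row_prod : ∀ x, O x 0 * O x 1 * O x 2 = 1
  col_prod : ∀ y, O 0 y * O 1 y * O 2 y = -1

theorem eq_of_mul_eq_one_of_mul_self {p q : R} (hq : q * q = 1) (h : p * q = 1) : p = q := by
  calc p = p * q * q := by rw [mul_assoc, hq, mul_one]
    _ = q := by rw [h, one_mul]

theorem eq_neg_of_mul_eq_neg_one_of_mul_self {p q : R} (hq : q * q = 1) (h : p * q = -1) :
    p = -q := by
  calc p = p * q * q := by rw [mul_assoc, hq, mul_one]
    _ = -q := by rw [h, neg_one_mul]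

/-- Permuting the columns of a magic square gives a magic square. -/
theorem IsMagicSquare.perm_columns {O : Fin 3 → Fin 3 → R} (h : IsMagicSquare O)
    (σ : Equiv.Perm (Fin 3)) : IsMagicSquare fun x y => O x (σ y) where
  mul_self _ _ := h.mul_self _ _
  row_comm _ _ _ := h.row_comm _ _ _
  col_comm _ _ _ := h.col_comm _ _ _
  col_prod _ := h.col_prod _
  row_prod x := by
    have h01 := (h.row_comm x 0 1).eq
    have h02 := (h.row_comm x 0 2).eq
    have h12 := (h.row_comm x 1 2).eq
    have hp := h.row_prod x
    have hne : σ 0 ≠ σ 1 ∧ σ 0 ≠ σ 2 ∧ σ 1 ≠ σ 2 := by simp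
    generalize σ 0 = i at *
    generalize σ 1 = j at *
    generalize σ 2 = k at *
    fin_cases i <;> fin_cases j <;> fin_cases k <;> simp at hne ⊢
    · exact hp
    · rw [mul_assoc, ← h12, ← mul_assoc, hp]
    · rw [← h01, hp]
    · rw [mul_assoc, ← h02, ← mul_assoc, ← h01, hp]
    · rw [← h02, mul_assoc, ← h12, ← mul_assoc, hp]
    · rw [← h12, mul_assoc, ← h02, ← mul_assoc, ← h01, hp]

/-- With rows `a b c`, `d e f`, `g h i`: the last row gives `i = gh = (ad)(be)` and the last column
gives `i = -cf = -(ab)(de)`. Cancelling the involutions `a` and `e` leaves `db = -bd`. -/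
theorem IsMagicSquare.anticomm {O : Fin 3 → Fin 3 → R} (h : IsMagicSquare O) :
    O 1 0 * O 0 1 = -(O 0 1 * O 1 0) := by
  have hc := eq_of_mul_eq_one_of_mul_self (h.mul_self 0 2) (h.row_prod 0)
  have hf := eq_of_mul_eq_one_of_mul_self (h.mul_self 1 2) (h.row_prod 1)
  have hi := eq_of_mul_eq_one_of_mul_self (h.mul_self 2 2) (h.row_prod 2)
  have hg := eq_neg_of_mul_eq_neg_one_of_mul_self (h.mul_self 2 0) (h.col_prod 0)
  have hh := eq_neg_of_mul_eq_neg_one_of_mul_self (h.mul_self 2 1) (h.col_prod 1)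
  have hi' := eq_neg_of_mul_eq_neg_one_of_mul_self (h.mul_self 2 2) (h.col_prod 2)
  have e : O 0 0 * (O 1 0 * O 0 1) * O 1 1 = O 0 0 * -(O 0 1 * O 1 0) * O 1 1 := by
    calc O 0 0 * (O 1 0 * O 0 1) * O 1 1 = (O 0 0 * O 1 0) * (O 0 1 * O 1 1) := by noncomm_ring
      _ = O 2 2 := by rw [hg, hh, neg_mul_neg, hi]
      _ = -((O 0 0 * O 0 1) * (O 1 0 * O 1 1)) := by rw [hc, hf, hi', neg_neg]
      _ = _ := by noncomm_ring
  have e' := congrArg (fun z => O 0 0 * z * O 1 1) e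
  have hl : ∀ z, O 0 0 * (O 0 0 * z * O 1 1) * O 1 1 = z := by
    intro z
    calc O 0 0 * (O 0 0 * z * O 1 1) * O 1 1 = (O 0 0 * O 0 0) * z * (O 1 1 * O 1 1) := by
          noncomm_ring
      _ = z := by rw [h.mul_self, h.mul_self, one_mul, mul_one]
  simpa only [hl] using e'

end Ring

/-- Conjugation by `p` preserves the trace and sends `q` to `-q`. -/
theorem Matrix.trace_eq_zero_of_anticomm {n K : Type*} [Fintype n] [DecidableEq n] [Field K]
    [CharZero K] {p q : Matrix n n K} (hp : p * p = 1) (h : p * q = -(q * p)) :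
    q.trace = 0 := by
  have h1 : (p * q * p).trace = q.trace := by
    rw [Matrix.trace_mul_comm, ← mul_assoc, hp, one_mul]
  have h2 : (p * q * p).trace = -q.trace := by
    rw [h, neg_mul, mul_assoc, hp, mul_one, Matrix.trace_neg]
  exact self_eq_neg.mp (h1.symm.trans h2)

/-- There is no magic square of `2 × 2` matrices. -/
theorem not_isMagicSquare_two {K : Type*} [Field K] [CharZero K]
    (O : Fin 3 → Fin 3 → Matrix (Fin 2) (Fin 2) K) : ¬ IsMagicSquare O := by
  intro h
  -- Up to a permutation of columns, every entry of the first row anticommutes with an entry of the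
  -- second.
  have t1 : (O 0 1).trace = 0 := Matrix.trace_eq_zero_of_anticomm (h.mul_self 1 0) h.anticomm
  have t0 : (O 0 0).trace = 0 := Matrix.trace_eq_zero_of_anticomm (h.mul_self 1 1)
    (by simpa using (h.perm_columns (Equiv.swap 0 1)).anticomm)
  have t2 : (O 0 2).trace = 0 := Matrix.trace_eq_zero_of_anticomm (h.mul_self 1 0)
    (by simpa [Equiv.swap_apply_of_ne_of_ne] using (h.perm_columns (Equiv.swap 1 2)).anticomm)
  have hc := eq_of_mul_eq_one_of_mul_self (h.mul_self 0 2) (h.row_prod 0)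
  have hz : O 0 2 = 0 := by
    have hcomm := (h.row_comm 0 0 1).eq
    rw [← hc] at t2 ⊢
    generalize O 0 0 = A at *
    generalize O 0 1 = B at *
    -- For traceless `2 × 2` matrices, `A * B + B * A` is the scalar `tr (A * B)`, which vanishes
    -- here. As `A` and `B` also commute, `A * B = 0`.
    have h2 : A * B + B * A = 0 := by
      simp only [Matrix.trace_fin_two, Matrix.mul_apply, Fin.sum_univ_two] at t0 t1 t2
      ext i j
      fin_cases i <;> fin_cases j <;>
        simp [Matrix.mul_apply, Fin.sum_univ_two] <;> grind
    rw [← hcomm, ← two_smul K] at h2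
    simpa using h2
  have := h.mul_self 0 2
  simp [hz] at this

/-! ### From winning strategies to magic squares -/

section Strategy
variable {R : Type*} [Ring R]

theorem bitSign_mul_self (c : Bool) : bitSign c * bitSign c = 1 := by cases c <;> rfl

/-- The observables of a family of operators whose products vanish on losing outputs form a magic
square. -/
theorem isMagicSquare_of_mul_eq_zero (M Q : Fin 3 → (Fin 3 → Bool) → R)
    (hM : ∀ x, ∑ a, M x a = 1) (hQ : ∀ y, ∑ b, Q y b = 1)
    (h : ∀ x y a b, ¬ magicSquareGame.rel x y a b → M x a * Q y b = 0) :
    IsMagicSquare fun x y => ∑ a, bitSign (a y) • M x a := by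
  -- Only winning pairs survive in the double sum, and they agree in the cell `(x, y)`.
  have hMQ : ∀ x y, ∑ a, bitSign (a y) • M x a = ∑ b, bitSign (b x) • Q y b := by
    intro x y
    calc ∑ a, bitSign (a y) • M x a = ∑ a, ∑ b, bitSign (a y) • (M x a * Q y b) := by
          simp only [← Finset.smul_sum, ← Finset.mul_sum, hQ, mul_one]
      _ = ∑ a, ∑ b, bitSign (b x) • (M x a * Q y b) := by
          refine Finset.sum_congr rfl fun a _ => Finset.sum_congr rfl fun b _ => ?_
          by_cases hab : magicSquareGame.rel x y a b
          · rw [hab.2.2]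
          · rw [h x y a b hab, smul_zero, smul_zero]
      _ = ∑ b, bitSign (b x) • Q y b := by
          rw [Finset.sum_comm]
          simp only [← Finset.smul_sum, ← Finset.sum_mul, hM, one_mul]
  -- This replaces projectivity of `M`, which is not assumed: the observable is rewritten through
  -- `Q`, whose surviving terms all carry the sign of `a y`.
  have hMO : ∀ x y a, M x a * ∑ a', bitSign (a' y) • M x a' = bitSign (a y) • M x a := by
    intro x y a
    calc M x a * ∑ a', bitSign (a' y) • M x a' = ∑ b, bitSign (b x) • (M x a * Q y b) := by
          simp only [hMQ, Finset.mul_sum, mul_smul_comm]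
      _ = ∑ b, bitSign (a y) • (M x a * Q y b) := by
          refine Finset.sum_congr rfl fun b _ => ?_
          by_cases hab : magicSquareGame.rel x y a b
          · rw [hab.2.2]
          · rw [h x y a b hab, smul_zero, smul_zero]
      _ = _ := by rw [← Finset.smul_sum, ← Finset.mul_sum, hQ, mul_one]
  have hOQ : ∀ x y b, (∑ b', bitSign (b' x) • Q y b') * Q y b = bitSign (b x) • Q y b := by
    intro x y b
    calc (∑ b', bitSign (b' x) • Q y b') * Q y b = ∑ a, bitSign (a y) • (M x a * Q y b) := by
          simp only [← hMQ, Finset.sum_mul, smul_mul_assoc]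
      _ = ∑ a, bitSign (b x) • (M x a * Q y b) := by
          refine Finset.sum_congr rfl fun a _ => ?_
          by_cases hab : magicSquareGame.rel x y a b
          · rw [hab.2.2]
          · rw [h x y a b hab, smul_zero, smul_zero]
      _ = _ := by rw [← Finset.smul_sum, ← Finset.sum_mul, hM, one_mul]
  have hMM : ∀ x y (f : (Fin 3 → Bool) → ℤ), (∑ a, f a • M x a) * ∑ a, bitSign (a y) • M x a =
      ∑ a, (f a * bitSign (a y)) • M x a := by
    intro x y f
    rw [Finset.sum_mul]
    simp only [smul_mul_assoc, hMO, smul_smul]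
  have hQQ : ∀ x y (f : (Fin 3 → Bool) → ℤ), (∑ b, bitSign (b x) • Q y b) * ∑ b, f b • Q y b =
      ∑ b, (f b * bitSign (b x)) • Q y b := by
    intro x y f
    rw [Finset.mul_sum]
    simp only [mul_smul_comm, hOQ, smul_smul]
  have hM0 : ∀ x a, a 2 ≠ xor (a 0) (a 1) → M x a = 0 := by
    intro x a ha
    calc M x a = ∑ b, M x a * Q 0 b := by rw [← Finset.mul_sum, hQ, mul_one]
      _ = 0 := Finset.sum_eq_zero fun b _ => h x 0 a b fun hab => ha hab.1
  have hQ0 : ∀ y b, b 2 ≠ xor (xor (b 0) (b 1)) true → Q y b = 0 := by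
    intro y b hb
    calc Q y b = ∑ a, M 0 a * Q y b := by rw [← Finset.sum_mul, hM, one_mul]
      _ = 0 := Finset.sum_eq_zero fun a _ => h 0 y a b fun hab => hb hab.2.1
  refine ⟨fun x y => ?_, fun x y y' => ?_, fun x x' y => ?_, fun x => ?_, fun y => ?_⟩
  · simp only [hMM, bitSign_mul_self, one_smul, hM]
  · rw [commute_iff_eq, hMM, hMM]
    simp only [mul_comm]
  · rw [commute_iff_eq, hMQ, hMQ, hQQ, hQQ]
    simp only [mul_comm]
  · rw [hMM, hMM, ← hM x]
    refine Finset.sum_congr rfl fun a _ => ?_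
    by_cases ha : a 2 = xor (a 0) (a 1)
    · have : bitSign (a 0) * bitSign (a 1) * bitSign (a 2) = 1 := by
        rw [ha]; cases a 0 <;> cases a 1 <;> rfl
      rw [this, one_smul]
    · rw [hM0 x a ha, smul_zero]
  -- `hQQ` absorbs observables from the left, so the product is taken right to left and the signs
  -- appear in the order 2, 1, 0.
  · rw [hMQ, hMQ, hMQ, mul_assoc, hQQ, hQQ, ← hQ y, ← Finset.sum_neg_distrib]
    refine Finset.sum_congr rfl fun b _ => ?_
    by_cases hb : b 2 = xor (xor (b 0) (b 1)) true
    · have : bitSign (b 2) * bitSign (b 1) * bitSign (b 0) = -1 := by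
        rw [hb]; cases b 0 <;> cases b 1 <;> rfl
      rw [this, neg_one_smul]
    · rw [hQ0 y b hb, smul_zero, neg_zero]

end Strategy

/-- No deterministic strategy wins the magic square game. -/
theorem magicSquareGame.not_forall_rel (a b : Fin 3 → Fin 3 → Bool) :
    ¬ ∀ x y, magicSquareGame.rel x y (a x) (b y) := by
  intro h
  have hr := fun x => (h x 0).1
  have hc := fun y => (h 0 y).2.1
  have he := fun x y => (h x y).2.2
  have hc2 := hc 2
  simp only [← he] at hc hc2
  -- The corner cell computed along the last row and along the last column yields opposite bits.
  rw [hr 2, hc 0, hc 1, hr 0, hr 1] at hc2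
  revert hc2
  cases a 0 0 <;> cases a 0 1 <;> cases a 1 0 <;> cases a 1 1 <;> decide

/-! Pairs of qubits. -/

section Born
variable {m n XA XB YA YB : Type} [Fintype m] [Fintype n]

theorem bornProb_nonneg (ψ : m × n → ℂ) {E : Matrix m m ℂ} {F : Matrix n n ℂ}
    (hE : E.PosSemidef) (hF : F.PosSemidef) : 0 ≤ bornProb ψ E F :=
  (hE.kronecker hF).re_dotProduct_nonneg ψ

theorem kronecker_mulVec_apply (ψ : m × n → ℂ) (E : Matrix m m ℂ) (F : Matrix n n ℂ) (i : m)
    (j : n) : ((E ⊗ₖ F) *ᵥ ψ) (i, j) = (E * Matrix.of (Function.curry ψ) * Fᵀ) i j := by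
  simp only [Matrix.mulVec, dotProduct, Fintype.sum_prod_type_right, Matrix.kroneckerMap_apply,
    Matrix.mul_apply, Matrix.transpose_apply, Matrix.of_apply, Function.curry_apply,
    Finset.sum_mul]
  refine Finset.sum_congr rfl fun l _ => Finset.sum_congr rfl fun k _ => by ring

/-- A positive semidefinite operator whose quadratic form vanishes at `ψ` annihilates `ψ`. The
conclusion views `ψ` as a matrix. -/
theorem mul_mul_transpose_eq_zero_of_bornProb_eq_zero (ψ : m × n → ℂ) {E : Matrix m m ℂ}
    {F : Matrix n n ℂ} (hE : E.PosSemidef) (hF : F.PosSemidef) (h : bornProb ψ E F = 0) :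
    E * Matrix.of (Function.curry ψ) * Fᵀ = 0 := by
  have hK := hE.kronecker hF
  have h0 : star ψ ⬝ᵥ ((E ⊗ₖ F) *ᵥ ψ) = 0 :=
    Complex.ext h (Complex.le_def.mp (hK.dotProduct_mulVec_nonneg ψ)).2.symm
  ext i j
  rw [← kronecker_mulVec_apply, (hK.dotProduct_mulVec_zero_iff ψ).mp h0]
  rfl

theorem bornProb_eq_sum (ψ : m × n → ℂ) (E : Matrix m m ℂ) (F : Matrix n n ℂ) :
    bornProb ψ E F = (∑ i, star (ψ i) * ∑ j, E i.1 j.1 * F i.2 j.2 * ψ j).re := rfl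

theorem measurable_bornProb {Ω : Type} [MeasurableSpace Ω] (ψ : m × n → ℂ)
    {E : Ω → Matrix m m ℂ} {F : Ω → Matrix n n ℂ} (hE : ∀ i j, Measurable fun ω => E ω i j)
    (hF : ∀ i j, Measurable fun ω => F ω i j) : Measurable fun ω => bornProb ψ (E ω) (F ω) := by
  simp only [bornProb_eq_sum]
  fun_prop

variable [DecidableEq m] [DecidableEq n] [Fintype YA] [Fintype YB]

theorem sum_bornProb (ψ : m × n → ℂ) (M : POVM m YA) (N : POVM n YB) :
    ∑ a, ∑ b, bornProb ψ (M.effect a) (N.effect b) = (star ψ ⬝ᵥ ψ).re := by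
  have h1 : ∑ a, ∑ b, (M.effect a) ⊗ₖ (N.effect b) = 1 := by
    rw [← Matrix.one_kronecker_one, ← M.sum_eq_one, ← N.sum_eq_one]
    ext i j
    simp only [Matrix.sum_apply, Matrix.kroneckerMap_apply, Finset.sum_mul_sum]
  simp only [bornProb, ← Complex.re_sum, ← dotProduct_sum, ← Matrix.sum_mulVec, h1,
    Matrix.one_mulVec]

/-- Shared randomness does not help to win a game with certainty. -/
theorem exists_isQuantum_isWonBy [Finite XA] [Finite XB] {ψ : m × n → ℂ}
    (hψ : (star ψ ⬝ᵥ ψ).re = 1) {G : BipartiteGame XA XB YA YB} {q : Correlation XA XB YA YB}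
    (hq : IsQuantumWithSharedRandomness ψ q) (hG : G.IsWonBy q) :
    ∃ p, IsQuantum ψ p ∧ G.IsWonBy p := by
  classical
  obtain ⟨Ω, _, μ, _, M, N, hM, hN, h⟩ := hq
  let B : Ω → Correlation XA XB YA YB := fun ω x y a b =>
    bornProb ψ ((M ω x).effect a) ((N ω y).effect b)
  let W : XA → XB → Ω → ℝ := fun x y ω => ∑ a, ∑ b, if G.rel x y a b then B ω x y a b else 0
  have hB0 : ∀ ω x y a b, 0 ≤ B ω x y a b := fun ω x y a b =>
    bornProb_nonneg ψ ((M ω x).posSemidef a) ((N ω y).posSemidef b)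
  have hBsum : ∀ ω x y, ∑ a, ∑ b, B ω x y a b = 1 := fun ω x y =>
    (sum_bornProb ψ (M ω x) (N ω y)).trans hψ
  have hB1 : ∀ ω x y a b, B ω x y a b ≤ 1 := by
    intro ω x y a b
    rw [← hBsum ω x y]
    exact (Finset.single_le_sum (f := fun b => B ω x y a b) (fun b _ => hB0 ω x y a b)
      (Finset.mem_univ b)).trans (Finset.single_le_sum (f := fun a => ∑ b, B ω x y a b)
      (fun a _ => Finset.sum_nonneg fun b _ => hB0 ω x y a b) (Finset.mem_univ a))
  have hBint : ∀ x y a b, MeasureTheory.Integrable (fun ω => B ω x y a b) μ := by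
    intro x y a b
    refine MeasureTheory.Integrable.of_bound
      (measurable_bornProb ψ (hM x a) (hN y b)).aestronglyMeasurable 1 (.of_forall fun ω => ?_)
    rw [Real.norm_eq_abs, abs_of_nonneg (hB0 ω x y a b)]
    exact hB1 ω x y a b
  have hWle : ∀ x y ω, W x y ω ≤ 1 := by
    intro x y ω
    rw [← hBsum ω x y]
    refine Finset.sum_le_sum fun a _ => Finset.sum_le_sum fun b _ => ?_
    split_ifs
    · exact le_rfl
    · exact hB0 ω x y a b
  have hif : ∀ x y a b,
      MeasureTheory.Integrable (fun ω => if G.rel x y a b then B ω x y a b else 0) μ := by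
    intro x y a b
    split_ifs
    · exact hBint x y a b
    · exact MeasureTheory.integrable_zero _ _ _
  have hWint : ∀ x y, MeasureTheory.Integrable (W x y) μ := fun x y =>
    MeasureTheory.integrable_finsetSum _ fun a _ => MeasureTheory.integrable_finsetSum _ fun b _ =>
      hif x y a b
  have hW : ∀ x y, ∫ ω, W x y ω ∂μ = 1 := by
    intro x y
    rw [← hG x y]
    simp only [W]
    rw [MeasureTheory.integral_finsetSum _ fun a _ =>
      MeasureTheory.integrable_finsetSum _ fun b _ => hif x y a b]
    refine Finset.sum_congr rfl fun a _ => ?_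
    rw [MeasureTheory.integral_finsetSum _ fun b _ => hif x y a b]
    refine Finset.sum_congr rfl fun b _ => ?_
    split_ifs
    · exact (h x y a b).symm
    · simp
  -- The losing probability `1 - W` is nonnegative with integral zero.
  have hae : ∀ x y, ∀ᵐ ω ∂μ, W x y ω = 1 := by
    intro x y
    have h0 : ∫ ω, (1 - W x y ω) ∂μ = 0 := by
      rw [MeasureTheory.integral_sub (MeasureTheory.integrable_const 1) (hWint x y), hW]
      simp
    rw [MeasureTheory.integral_eq_zero_iff_of_nonneg (fun ω => sub_nonneg.mpr (hWle x y ω))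
      ((MeasureTheory.integrable_const 1).sub (hWint x y))] at h0
    filter_upwards [h0] with ω hω
    exact (sub_eq_zero.mp hω).symm
  have hall : ∀ᵐ ω ∂μ, ∀ x y, W x y ω = 1 :=
    MeasureTheory.ae_all_iff.mpr fun x => MeasureTheory.ae_all_iff.mpr (hae x)
  obtain ⟨ω, hω⟩ := hall.exists
  exact ⟨B ω, ⟨M ω, N ω, fun _ _ _ _ => rfl⟩, hω⟩

/-- Measurements that win a game with certainty annihilate the state on losing outputs. -/
theorem mul_mul_transpose_eq_zero_of_isWonBy {ψ : m × n → ℂ} (hψ : (star ψ ⬝ᵥ ψ).re = 1)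
    {G : BipartiteGame XA XB YA YB} {M : XA → POVM m YA} {N : XB → POVM n YB}
    (hG : G.IsWonBy fun x y a b => bornProb ψ ((M x).effect a) ((N y).effect b))
    {x : XA} {y : XB} {a : YA} {b : YB} (hab : ¬ G.rel x y a b) :
    (M x).effect a * Matrix.of (Function.curry ψ) * ((N y).effect b)ᵀ = 0 := by
  classical
  refine mul_mul_transpose_eq_zero_of_bornProb_eq_zero ψ ((M x).posSemidef a)
    ((N y).posSemidef b) ?_
  have h0 : ∀ a b, 0 ≤ bornProb ψ ((M x).effect a) ((N y).effect b) := fun a b =>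
    bornProb_nonneg ψ ((M x).posSemidef a) ((N y).posSemidef b)
  -- The summands are the probabilities of the losing outputs.
  have hlose : ∑ a, ∑ b, (bornProb ψ ((M x).effect a) ((N y).effect b) -
      if G.rel x y a b then bornProb ψ ((M x).effect a) ((N y).effect b) else 0) = 0 := by
    simp only [Finset.sum_sub_distrib]
    rw [sum_bornProb, hψ, hG x y, sub_self]
  have hnn : ∀ a b, 0 ≤ bornProb ψ ((M x).effect a) ((N y).effect b) -
      if G.rel x y a b then bornProb ψ ((M x).effect a) ((N y).effect b) else 0 := by
    intro a b
    split_ifs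
    · rw [sub_self]
    · rw [sub_zero]; exact h0 a b
  rw [Finset.sum_eq_zero_iff_of_nonneg fun a _ => Finset.sum_nonneg fun b _ => hnn a b] at hlose
  have hb := hlose a (Finset.mem_univ a)
  rw [Finset.sum_eq_zero_iff_of_nonneg fun b _ => hnn a b] at hb
  simpa [hab] using hb b (Finset.mem_univ b)

end Born

theorem POVM.exists_effect_apply_ne_zero {n Y : Type} [Fintype n] [DecidableEq n] [Fintype Y]
    (M : POVM n Y) (k : n) : ∃ a, M.effect a k k ≠ 0 := by
  by_contra! h
  have := congrFun (congrFun M.sum_eq_one k) k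
  simp [Matrix.sum_apply, h] at this

theorem of_curry_qubitPair (α β : ℂ) :
    Matrix.of (Function.curry (qubitPair α β)) = Matrix.diagonal ![α, β] := by
  ext i j
  fin_cases i <;> fin_cases j <;> simp [qubitPair]

theorem star_qubitPair_dotProduct {α β : ℂ} (h : ‖α‖ ^ 2 + ‖β‖ ^ 2 = 1) :
    (star (qubitPair α β) ⬝ᵥ qubitPair α β).re = 1 := by
  have : star (qubitPair α β) ⬝ᵥ qubitPair α β = ((‖α‖ ^ 2 + ‖β‖ ^ 2 : ℝ) : ℂ) := by
    simp [dotProduct, Fintype.sum_prod_type, qubitPair, Pi.single_apply, Complex.conj_mul']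
  rw [this, h, Complex.ofReal_re]

theorem not_isWonBy_of_isQuantum_qubitPair {α β : ℂ} (h : ‖α‖ ^ 2 + ‖β‖ ^ 2 = 1)
    {p : Correlation (Fin 3) (Fin 3) (Fin 3 → Bool) (Fin 3 → Bool)}
    (hp : IsQuantum (qubitPair α β) p) : ¬ magicSquareGame.IsWonBy p := by
  intro hwin
  obtain ⟨M, N, hMN⟩ := hp
  obtain rfl : p = fun x y a b => bornProb _ ((M x).effect a) ((N y).effect b) := by
    funext x y a b; exact hMN x y a b
  have hz : ∀ x y a b, ¬ magicSquareGame.rel x y a b →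
      (M x).effect a * Matrix.diagonal ![α, β] * ((N y).effect b)ᵀ = 0 := fun x y a b hab => by
    rw [← of_curry_qubitPair]
    exact mul_mul_transpose_eq_zero_of_isWonBy (star_qubitPair_dotProduct h) hwin hab
  by_cases hαβ : ∀ k, ![α, β] k ≠ 0
  · have hD : Matrix.diagonal ![α, β] * Matrix.diagonal ![α, β]⁻¹ = 1 := by
      rw [Matrix.diagonal_mul_diagonal, ← Matrix.diagonal_one]
      congr 1
      funext k
      exact mul_inv_cancel₀ (hαβ k)
    -- Bob's transported operators need not be positive; they only have to sum to `1`.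
    refine not_isMagicSquare_two _ (isMagicSquare_of_mul_eq_zero (fun x a => (M x).effect a)
      (fun y b => Matrix.diagonal ![α, β] * ((N y).effect b)ᵀ * Matrix.diagonal ![α, β]⁻¹)
      (fun x => (M x).sum_eq_one) (fun y => ?_) fun x y a b hab => ?_)
    · rw [← Finset.sum_mul, ← Finset.mul_sum, ← Matrix.transpose_sum, (N y).sum_eq_one,
        Matrix.transpose_one, mul_one, hD]
    · rw [← mul_assoc, ← mul_assoc, hz x y a b hab, zero_mul]
  · push Not at hαβ
    obtain ⟨k, hk, hl⟩ : ∃ k, ![α, β] k ≠ 0 ∧ ∀ i, i ≠ k → ![α, β] i = 0 := by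
      obtain ⟨i, hi⟩ := hαβ
      by_cases hα : α = 0
      · exact ⟨1, fun hβ => by simp_all, fun i hi => by fin_cases i <;> simp_all⟩
      · exact ⟨0, hα, fun j hj => by fin_cases i <;> fin_cases j <;> simp_all⟩
    -- The state is a multiple of `|kk⟩`. Each player fixes an outcome of nonzero probability for
    -- each input; a losing pair would then have nonzero probability.
    choose a ha using fun x => (M x).exists_effect_apply_ne_zero k
    choose b hb using fun y => (N y).exists_effect_apply_ne_zero k
    refine magicSquareGame.not_forall_rel a b fun x y => by_contra fun hab => ?_
    have hkk := congrFun (congrFun (hz x y _ _ hab) k) k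
    rw [Matrix.mul_apply, Finset.sum_eq_single k (fun i _ hi => by
      rw [Matrix.mul_diagonal, hl i hi, mul_zero, zero_mul]) (by simp), Matrix.mul_diagonal] at hkk
    exact mul_ne_zero (mul_ne_zero (ha x) hk) (hb y) hkk

theorem not_isWonBy_of_isQuantumWithSharedRandomness_qubitPair {α β : ℂ}
    (h : ‖α‖ ^ 2 + ‖β‖ ^ 2 = 1) {q : Correlation (Fin 3) (Fin 3) (Fin 3 → Bool) (Fin 3 → Bool)}
    (hq : IsQuantumWithSharedRandomness (qubitPair α β) q) : ¬ magicSquareGame.IsWonBy q := by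
  intro hwin
  obtain ⟨p, hp, hpwin⟩ := exists_isQuantum_isWonBy (star_qubitPair_dotProduct h) hq hwin
  exact not_isWonBy_of_isQuantum_qubitPair h hp hpwin

theorem mainTheorem11 :
    -- the magic square correlations are those of a quantum winning strategy
    magicSquareGame.IsWonBy magicSquareCorrelation ∧
    IsQuantum magicState magicSquareCorrelation ∧
    -- one use of a non-local box simulates them
    (∃ P : NLBProtocol (Fin 3) (Fin 3) (Fin 3 → Bool) (Fin 3 → Bool),
      P.correlation = magicSquareCorrelation) ∧
    -- no pair of qubits produces them, or any other correlation that wins the game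
    (∀ α β : ℂ, ‖α‖ ^ 2 + ‖β‖ ^ 2 = 1 →
      ¬ IsQuantumWithSharedRandomness (qubitPair α β) magicSquareCorrelation ∧
      ∀ q : Correlation (Fin 3) (Fin 3) (Fin 3 → Bool) (Fin 3 → Bool),
        IsQuantumWithSharedRandomness (qubitPair α β) q → ¬ magicSquareGame.IsWonBy q) := by
  exact ⟨magicSquareGame.isWonBy_magicSquareCorrelation, isQuantum_magicSquareCorrelation,
    ⟨magicSquareProtocol, magicSquareProtocol_correlation⟩, fun α β h =>
    ⟨fun hq => not_isWonBy_of_isQuantumWithSharedRandomness_qubitPair h hq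
      magicSquareGame.isWonBy_magicSquareCorrelation,
      fun q hq => not_isWonBy_of_isQuantumWithSharedRandomness_qubitPair h hq⟩⟩
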